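/- Finite binary strings and infinite binary sequences $\omega=\omega_1\omega_2\dots$ are considered; $l(x)$ is the length of a string $x$, $\omega^n=\omega_1\dots\omega_n$, and $x\subseteq y$ means that $x$ is an initial segment of $y$ (where $y$ is a string or an infinite sequence). A computable monotone operation is represented by a recursively enumerable set $\hat\psi$ of pairs of strings such that (a) if $(p,y),(p',y')\in\hat\psi$ and $p\subseteq p'$, then $y\subseteq y'$ or $y'\subseteq y$; (b) if $(p,y)\in\hat\psi$ and $y'\subseteq y$, then $(p,y')\in\hat\psi$. Put $Km_\psi(x)=\min\{l(p):(p,x)\in\hat\psi\}$ (with $\min\emptyset=+\infty$). The operation $\psi$ is optimal if for each computable monotone operation $\psi'$ there is a constant $c$ such that $Km_\psi(x)\le Km_{\psi'}(x)+c$ for all strings $x$. The monotone complexity is $Km=Km_\psi$ for a fixed optimal $\psi$. A computable sequence of total Solovay tests is a computable double sequence of strings ${\cal T}_k=\{x_{k,n}:n=1,2,\dots\}$, $k=1,2,\dots$, for which there is a computable function $m(\delta,k)$ such that $\sum_{i=m(\delta,k)}^\infty 2^{-l(x_{k,i})}\le\delta$ for each $k$ and each rational $\delta>0$. A sequence $\omega$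 passes the test ${\cal T}_k$ if $x_{k,n}\not\subseteq\omega$ for all but finitely many $n$. Theorem. For any computable sequence of total Solovay tests ${\cal T}_k$, $k=1,2,\dots$, there exists a computable nondecreasing unbounded function $\rho:\mathbb N\to\mathbb N$, which does not depend on the choice of the optimal operation defining $Km$, such that every infinite binary sequence $\omega$ for which there is a constant $c$ (which may depend on $\omega$) with $Km(\omega^n)\ge n-\rho(n)-c$ for all sufficiently large $n$ passes the test ${\cal T}_k$ for every $k$. -/

import Mathlib

open Filter

/-! Finite binary strings are `List Bool`, infinite binary sequences are `ℕ → Bool`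
(indexed from `0`), and `x <+: y` says that the string `x` is an initial segment of `y`. -/

/-- `initial ω n` is the string formed by the first `n` bits of the infinite sequence `ω`. -/
def initial (ω : ℕ → Bool) (n : ℕ) : List Bool :=
  (List.range n).map ω

/-- The finite string `x` is an initial segment of the infinite sequence `ω`. -/
def IsInitialOf (x : List Bool) (ω : ℕ → Bool) : Prop :=
  ∃ n : ℕ, x = initial ω n

/-! ### Monotone complexity -/

/-- A computable representation of a monotone operation on binary sequences: a recursively
enumerable set of pairs (program, output) such that outputs of comparable programs are comparable,
and such that an output may be replaced by any of its initial segments. -/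
structure IsMonotoneRepresentation (ψ : Set (List Bool × List Bool)) : Prop where
  re : REPred fun a : List Bool × List Bool => a ∈ ψ
  comparable : ∀ p y p' y' : List Bool, (p, y) ∈ ψ → (p', y') ∈ ψ → p <+: p' →
    y <+: y' ∨ y' <+: y
  downward : ∀ p y y' : List Bool, (p, y) ∈ ψ → y' <+: y → (p, y') ∈ ψ

/-- The measure of complexity determined by `ψ`: the least length of a program `p` with
`(p, x) ∈ ψ`, and `⊤` if there is no such program. -/
noncomputable def monotoneComplexity (ψ : Set (List Bool × List Bool)) (x : List Bool) : ℕ∞ :=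
  ⨅ (p : List Bool) (_ : (p, x) ∈ ψ), (p.length : ℕ∞)

/-- `ψ` represents an optimal monotone operation: its complexity is, up to an additive constant,
at most the complexity determined by any other computable monotone operation. The monotone
complexity `Km` is `monotoneComplexity ψ` for a fixed optimal `ψ`; it depends on
the choice of `ψ` only up to an additive constant. -/
def IsOptimalMonotone (ψ : Set (List Bool × List Bool)) : Prop :=
  IsMonotoneRepresentation ψ ∧
    ∀ ψ' : Set (List Bool × List Bool), IsMonotoneRepresentation ψ' →
      ∃ c : ℕ, ∀ x : List Bool, monotoneComplexity ψ x ≤ monotoneComplexity ψ' x + c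

/-! ### Total Solovay tests -/

/-- `x` is a computable sequence of total Solovay tests; the `k`-th test is the sequence of strings
`x k 0, x k 1, …`. The double sequence of strings is computable, and the series
`∑ i, 2 ^ (-length (x k i))` converge with a rate that is computable uniformly in `k`:
`m (a, b) k` is a bound that works for the positive rational number `δ = a / b`. The sum is taken in
`[0, ∞]`, so that the inequality for the tail includes the convergence of the series. -/
def IsComputableTestSequence (x : ℕ → ℕ → List Bool) : Prop :=
  Computable₂ x ∧
    ∃ m : ℕ × ℕ → ℕ → ℕ, Computable₂ m ∧
      ∀ (k a b : ℕ), 0 < a → 0 < b →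
        ∑' i : ℕ, ((2 : ENNReal) ^ (x k (m (a, b) k + i)).length)⁻¹ ≤ (a : ENNReal) / (b : ENNReal)

/-- The infinite sequence `ω` passes the test `x 0, x 1, …`: all but finitely many strings of the
test are not initial segments of `ω`. -/
def PassesTest (ω : ℕ → Bool) (x : ℕ → List Bool) : Prop :=
  ∀ᶠ n in atTop, ¬ IsInitialOf (x n) ω

/-! ### Computable functions -/

/-! The strings in a far tail of a test have small total measure, so they can be coded by shorter
words. For every pair `r`, `k`, the tail of the `k`-th test of weight at most `8 ^ (-(r + k))` gets
code words that save about `2 * r` bits. The weights of all these requests sum to at most 1, so a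
computable Kraft code satisfies them at once and gives a single monotone operation
(`IsTestModulus.exists_monotone_operation`). The rate grows so slowly that a test string whose
length has rate `r + 1` already lies in the `r`-th tail of its test, provided `k ≤ r`
(`tailIndex_le_of_lt_testRate`). Its complexity then drops by about `2 * r`, while the hypothesis on
`ω` allows a drop of only `r + 1` plus a constant. Hence only finitely many strings of the test are
initial segments of `ω`. The rate is built from the tests and their modulus alone, so it does not
depend on the optimal operation. -/

theorem Primrec.nat_pow : Primrec₂ ((· ^ ·) : ℕ → ℕ → ℕ) :=
  Primrec₂.unpaired'.1 Nat.Primrec.pow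

theorem Computable.sum_range {α : Type*} [Primcodable α] {n : α → ℕ} {f : α → ℕ → ℕ}
    (hn : Computable n) (hf : Computable₂ f) :
    Computable fun a => ∑ i ∈ Finset.range (n a), f a i := by
  have step : Computable₂ fun (a : α) (q : ℕ × ℕ) => q.2 + f a q.1 :=
    (Primrec.nat_add.to_comp.comp (Computable.snd.comp Computable.snd)
      (hf.comp Computable.fst (Computable.fst.comp Computable.snd))).to₂
  refine (Computable.nat_rec hn (Computable.const 0) step).of_eq fun a => ?_
  induction n a with
  | zero => simp
  | succ k ih => rw [Finset.sum_range_succ, ← ih]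

theorem REPred.exists_nat {α : Type*} [Primcodable α] {P : α → ℕ → Prop}
    (hP : ComputablePred fun q : α × ℕ => P q.1 q.2) : REPred fun a => ∃ n, P a n := by
  classical
  have hc : Computable fun q : α × ℕ => decide (P q.1 q.2) := hP.decide
  have h : Partrec fun a => Nat.rfind fun n => Part.some (decide (P a n)) :=
    Partrec.rfind (p := fun a n => Part.some (decide (P a n))) hc.partrec
  refine h.dom_re.of_eq fun a => ?_
  refine Nat.rfind_dom'.trans ⟨?_, ?_⟩
  · rintro ⟨n, hn, -⟩
    exact ⟨n, by simpa using hn⟩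
  · rintro ⟨n, hn⟩
    exact ⟨n, by simpa using hn, fun _ => trivial⟩

/-! ### Strings as binary numerals -/

/-- The number with binary expansion `p`, most significant digit first. -/
def binaryValue (p : List Bool) : ℕ :=
  p.foldl (fun a b => 2 * a + b.toNat) 0

theorem computable_binaryValue : Computable binaryValue := by
  have step : Primrec₂ fun (_ : List Bool) (q : ℕ × Bool) => 2 * q.1 + q.2.toNat :=
    (Primrec.nat_add.comp
      (Primrec.nat_mul.comp (Primrec.const 2) (Primrec.fst.comp Primrec.snd))
      ((Primrec.dom_bool Bool.toNat).comp (Primrec.snd.comp Primrec.snd))).to₂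
  exact (Primrec.list_foldl Primrec.id (Primrec.const 0) step).to_comp

theorem binaryValue_concat (p : List Bool) (b : Bool) :
    binaryValue (p ++ [b]) = 2 * binaryValue p + b.toNat := by
  simp [binaryValue]

theorem binaryValue_append_mem (p t : List Bool) :
    binaryValue p * 2 ^ t.length ≤ binaryValue (p ++ t) ∧
      binaryValue (p ++ t) + 1 ≤ (binaryValue p + 1) * 2 ^ t.length := by
  induction t using List.reverseRecOn with
  | nil => simp
  | append_singleton t b ih =>
    have hb := Bool.toNat_le b
    rw [← List.append_assoc, binaryValue_concat, List.length_append, List.length_singleton,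
      pow_succ]
    constructor <;> nlinarith [ih.1, ih.2]

theorem exists_binaryValue_eq (w n : ℕ) (hn : n < 2 ^ w) :
    ∃ p : List Bool, p.length = w ∧ binaryValue p = n := by
  induction w generalizing n with
  | zero => exact ⟨[], rfl, by simp [binaryValue]; omega⟩
  | succ w ih =>
    obtain ⟨p, hp, hv⟩ := ih (n / 2) (by rw [pow_succ] at hn; omega)
    refine ⟨p ++ [decide (n % 2 = 1)], by simp [hp], ?_⟩
    rw [binaryValue_concat, hv]
    rcases Nat.mod_two_eq_zero_or_one n with h | h <;> simp [h] <;> omega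

/-- The left end of the dyadic interval of the infinite sequences that extend `p`. -/
noncomputable def dyadicLeft (p : List Bool) : ℝ :=
  binaryValue p / 2 ^ p.length

theorem dyadicLeft_mem_of_prefix {p p' : List Bool} (h : p <+: p') :
    dyadicLeft p ≤ dyadicLeft p' ∧ dyadicLeft p' < dyadicLeft p + 1 / 2 ^ p.length := by
  obtain ⟨t, rfl⟩ := h
  obtain ⟨h₁, h₂⟩ := binaryValue_append_mem p t
  have h₁' : (binaryValue p : ℝ) * 2 ^ t.length ≤ binaryValue (p ++ t) := by exact_mod_cast h₁
  have h₂' : (binaryValue (p ++ t) : ℝ) + 1 ≤ (binaryValue p + 1) * 2 ^ t.length := by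
    exact_mod_cast h₂
  unfold dyadicLeft
  rw [List.length_append, pow_add, ← add_div]
  constructor
  · rw [div_le_div_iff₀ (by positivity) (by positivity)]
    nlinarith [pow_pos (two_pos : (0 : ℝ) < 2) p.length]
  · rw [div_lt_div_iff₀ (by positivity) (by positivity)]
    nlinarith [pow_pos (two_pos : (0 : ℝ) < 2) p.length]

/-! ### Codes of prescribed lengths -/

/-- The number that has as its `e s + 1` binary digits the code word for the `s`-th request, when
the `s`-th request asks for length `e s`: with `A = ∑ t < s, 2 ^ (-e t)`, it is
`⌊A * 2 ^ (e s + 1)⌋ + 1`. -/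
def kraftCode (e : ℕ → ℕ) (s : ℕ) : ℕ :=
  (∑ t ∈ Finset.range s, 2 ^ (∑ u ∈ Finset.range s, e u - e t)) * 2 ^ (e s + 1) /
    2 ^ (∑ u ∈ Finset.range s, e u) + 1

theorem computable_kraftCode {e : ℕ → ℕ} (he : Computable e) : Computable (kraftCode e) := by
  have total : Computable fun s : ℕ => ∑ u ∈ Finset.range s, e u :=
    Computable.sum_range (f := fun _ u => e u) Computable.id (he.comp Computable.snd).to₂
  have two_pow : Computable fun n : ℕ => 2 ^ n :=
    Primrec.nat_pow.to_comp.comp (Computable.const 2) Computable.id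
  have numerator : Computable fun s : ℕ =>
      ∑ t ∈ Finset.range s, 2 ^ (∑ u ∈ Finset.range s, e u - e t) :=
    Computable.sum_range (f := fun s t => 2 ^ (∑ u ∈ Finset.range s, e u - e t)) Computable.id
      (two_pow.comp (Primrec.nat_sub.to_comp.comp (total.comp Computable.fst)
        (he.comp Computable.snd))).to₂
  exact Computable.succ.comp (Primrec.nat_div.to_comp.comp
    (Primrec.nat_mul.to_comp.comp numerator (two_pow.comp (Computable.succ.comp he)))
    (two_pow.comp total))

/-- The request `s` owns the interval `[A, A + 2 ^ (-e s)]`, where `A` is the weight of the earlier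
requests. It need not be dyadic, but it contains a dyadic interval of half its length, starting at
the first grid point after `A`. One extra bit thus allows requests in any order. -/
theorem kraftCode_bounds (e : ℕ → ℕ) (s : ℕ) :
    (∑ t ∈ Finset.range s, (1 / 2 ^ e t : ℝ)) < kraftCode e s / 2 ^ (e s + 1) ∧
      ((kraftCode e s : ℝ) + 1) / 2 ^ (e s + 1) ≤
        ∑ t ∈ Finset.range (s + 1), (1 / 2 ^ e t : ℝ) := by
  set E := ∑ u ∈ Finset.range s, e u with hE
  set N := ∑ t ∈ Finset.range s, 2 ^ (E - e t) with hN
  set A := ∑ t ∈ Finset.range s, (1 / 2 ^ e t : ℝ) with hA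
  have hNA : (N : ℝ) = A * 2 ^ E := by
    rw [hN, hA, Finset.sum_mul, Nat.cast_sum]
    refine Finset.sum_congr rfl fun t ht => ?_
    -- `2 ^ E` serves as a common denominator; this bound makes the truncated subtraction `E - e t`
    -- exact.
    have hle : e t ≤ E := Finset.single_le_sum (f := e) (fun _ _ => Nat.zero_le _) ht
    have : (2 : ℝ) ^ E = 2 ^ (E - e t) * 2 ^ e t := by rw [← pow_add, Nat.sub_add_cancel hle]
    rw [this]
    push_cast
    field_simp
  have hcode : kraftCode e s = N * 2 ^ (e s + 1) / 2 ^ E + 1 := rfl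
  set q := N * 2 ^ (e s + 1) / 2 ^ E with hq
  have h₁ : q * 2 ^ E ≤ N * 2 ^ (e s + 1) := Nat.div_mul_le_self _ _
  have h₂ : N * 2 ^ (e s + 1) < (q + 1) * 2 ^ E := by
    rw [mul_comm (q + 1)]
    exact Nat.lt_mul_div_succ _ (by positivity)
  have h₁' : (q : ℝ) * 2 ^ E ≤ A * 2 ^ (e s + 1) * 2 ^ E := by
    have : (q : ℝ) * 2 ^ E ≤ N * 2 ^ (e s + 1) := by exact_mod_cast h₁
    rw [hNA] at this
    linarith
  have h₂' : A * 2 ^ (e s + 1) * 2 ^ E < ((q : ℝ) + 1) * 2 ^ E := by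
    have : (N : ℝ) * 2 ^ (e s + 1) < ((q : ℝ) + 1) * 2 ^ E := by exact_mod_cast h₂
    rw [hNA] at this
    linarith
  have h₃ := le_of_mul_le_mul_right h₁' (by positivity)
  have h₄ := lt_of_mul_lt_mul_right h₂' (by positivity)
  rw [Finset.sum_range_succ, ← hA, hcode]
  push_cast
  constructor
  · rw [lt_div_iff₀ (by positivity)]
    exact h₄
  · rw [div_le_iff₀ (by positivity), add_mul]
    have : (1 / 2 ^ e s : ℝ) * 2 ^ (e s + 1) = 2 := by
      rw [pow_succ]
      field_simp
    rw [this]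
    linarith

/-- `p` is the code word of the `s`-th request. -/
def IsKraftWord (e : ℕ → ℕ) (s : ℕ) (p : List Bool) : Prop :=
  p.length = e s + 1 ∧ binaryValue p = kraftCode e s

/-- Code words of different requests have disjoint dyadic intervals, while the interval of an
extension lies inside that of its prefix. So the code is prefix-free, which gives the comparability
condition for `kraftOperation`. -/
theorem IsKraftWord.eq_of_prefix {e : ℕ → ℕ} {s s' : ℕ} {p p' : List Bool}
    (h : IsKraftWord e s p) (h' : IsKraftWord e s' p') (hp : p <+: p') : s = s' := by
  have key : ∀ {r : ℕ} {q : List Bool}, IsKraftWord e r q →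
      (∑ t ∈ Finset.range r, (1 / 2 ^ e t : ℝ)) < dyadicLeft q ∧
        dyadicLeft q + 1 / 2 ^ q.length ≤ ∑ t ∈ Finset.range (r + 1), (1 / 2 ^ e t : ℝ) := by
    rintro r q ⟨hl, hv⟩
    have := kraftCode_bounds e r
    rwa [dyadicLeft, hl, hv, ← add_div]
  have mono : Monotone fun n => ∑ t ∈ Finset.range n, (1 / 2 ^ e t : ℝ) := fun a b hab =>
    Finset.sum_le_sum_of_subset_of_nonneg (Finset.range_mono hab) fun _ _ _ => by positivity
  obtain ⟨h₁, h₂⟩ := key h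
  obtain ⟨h₁', h₂'⟩ := key h'
  obtain ⟨h₃, h₄⟩ := dyadicLeft_mem_of_prefix hp
  have pos : (0 : ℝ) < 1 / 2 ^ p'.length := by positivity
  rcases lt_trichotomy s s' with hlt | heq | hgt
  · have := mono (Nat.succ_le_of_lt hlt)
    simp only at this
    linarith
  · exact heq
  · have := mono (Nat.succ_le_of_lt hgt)
    simp only at this
    linarith

theorem exists_isKraftWord {e : ℕ → ℕ}
    (he : ∀ n, ∑ t ∈ Finset.range n, (1 / 2 ^ e t : ℝ) ≤ 1) (s : ℕ) :
    ∃ p, IsKraftWord e s p := by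
  have h := (kraftCode_bounds e s).2.trans (he (s + 1))
  rw [div_le_one (by positivity)] at h
  have h' : kraftCode e s + 1 ≤ 2 ^ (e s + 1) := by exact_mod_cast h
  exact exists_binaryValue_eq _ _ h'

/-- The monotone operation that maps the code word of the `s`-th request to `y s`. -/
def kraftOperation (e : ℕ → ℕ) (y : ℕ → List Bool) : Set (List Bool × List Bool) :=
  {a | ∃ s, IsKraftWord e s a.1 ∧ a.2 <+: y s}

theorem isMonotoneRepresentation_kraftOperation {e : ℕ → ℕ} {y : ℕ → List Bool}
    (he : Computable e) (hy : Computable y) :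
    IsMonotoneRepresentation (kraftOperation e y) where
  re := by
    have word : Computable fun q : (List Bool × List Bool) × ℕ => q.1.1 :=
      Computable.fst.comp Computable.fst
    have out : Computable fun q : (List Bool × List Bool) × ℕ => q.1.2 :=
      Computable.snd.comp Computable.fst
    have h₁ : Computable fun q : (List Bool × List Bool) × ℕ =>
        decide (q.1.1.length = e q.2 + 1) :=
      Primrec.eq.decide.to_comp.comp (Computable.list_length.comp word)
        (Computable.succ.comp (he.comp Computable.snd))
    have h₂ : Computable fun q : (List Bool × List Bool) × ℕ =>
        decide (binaryValue q.1.1 = kraftCode e q.2) :=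
      Primrec.eq.decide.to_comp.comp (computable_binaryValue.comp word)
        ((computable_kraftCode he).comp Computable.snd)
    have h₃ : Computable fun q : (List Bool × List Bool) × ℕ =>
        decide (q.1.2 = (y q.2).take q.1.2.length) :=
      Primrec.eq.decide.to_comp.comp out
        (Primrec.list_take.to_comp.comp (Computable.list_length.comp out)
          (hy.comp Computable.snd))
    have h := Primrec.and.to_comp.comp (Primrec.and.to_comp.comp h₁ h₂) h₃
    refine (REPred.exists_nat (P := fun (a : List Bool × List Bool) s =>
      (a.1.length = e s + 1 ∧ binaryValue a.1 = kraftCode e s) ∧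
        a.2 = (y s).take a.2.length) ?_).of_eq fun a => ?_
    · refine Computable.computablePred (h.of_eq fun q => ?_)
      simp only [Bool.decide_and]
    · change _ ↔ ∃ s, IsKraftWord e s a.1 ∧ a.2 <+: y s
      simp only [IsKraftWord, List.prefix_iff_eq_take]
  comparable := by
    rintro p z p' z' ⟨s, hs, hz⟩ ⟨s', hs', hz'⟩ hp
    obtain rfl := hs.eq_of_prefix hs' hp
    exact List.prefix_or_prefix_of_prefix hz hz'
  downward := by
    rintro p z z' ⟨s, hs, hz⟩ hz'
    exact ⟨s, hs, hz'.trans hz⟩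

theorem monotoneComplexity_kraftOperation_le {e : ℕ → ℕ} (y : ℕ → List Bool)
    (he : ∑' t, ((2 : ENNReal) ^ e t)⁻¹ ≤ 1) (s : ℕ) :
    monotoneComplexity (kraftOperation e y) (y s) ≤ (e s + 1 : ℕ) := by
  have hreal : ∀ n, ∑ t ∈ Finset.range n, (1 / 2 ^ e t : ℝ) ≤ 1 := by
    intro n
    have h := (ENNReal.sum_le_tsum (f := fun t => ((2 : ENNReal) ^ e t)⁻¹)
      (Finset.range n)).trans he
    have h' := ENNReal.toReal_mono ENNReal.one_ne_top h
    rw [ENNReal.toReal_sum fun t _ => by simp] at h'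
    simpa using h'
  obtain ⟨p, hp⟩ := exists_isKraftWord hreal s
  rw [← hp.1]
  exact iInf₂_le p ⟨s, hp, List.prefix_rfl⟩

/-! ### Saving bits on the strings of a test -/

/-- A bound for `δ = 8 ^ (-(r + k))` of the `k`-th test. -/
def tailIndex (m : ℕ × ℕ → ℕ → ℕ) (r k : ℕ) : ℕ :=
  m (1, 8 ^ (r + k)) k

theorem computable_tailIndex {m : ℕ × ℕ → ℕ → ℕ} (hm : Computable₂ m) :
    Computable₂ (tailIndex m) :=
  (hm.comp
    ((Computable.const 1).pair (Primrec.nat_pow.to_comp.comp (Computable.const 8)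
      (Primrec.nat_add.to_comp.comp Computable.fst Computable.snd)))
    Computable.snd).to₂

/-- The string of the request `(r, k, i)`: the `i`-th string in the tail of the `k`-th test from
`tailIndex m r k` on. -/
def tailString (x : ℕ → ℕ → List Bool) (m : ℕ × ℕ → ℕ → ℕ) (a : ℕ × ℕ × ℕ) : List Bool :=
  x a.2.1 (tailIndex m a.1 a.2.1 + a.2.2)

/-- The length of a code word for `tailString x m (r, k, i)`, shorter than the string itself by
`2 * r - 2`. -/
def tailLength (x : ℕ → ℕ → List Bool) (m : ℕ × ℕ → ℕ → ℕ) (a : ℕ × ℕ × ℕ) : ℕ :=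
  (tailString x m a).length + 2 - 2 * a.1

theorem computable_tailString {x : ℕ → ℕ → List Bool} {m : ℕ × ℕ → ℕ → ℕ}
    (hx : Computable₂ x) (hm : Computable₂ m) : Computable (tailString x m) :=
  hx.comp (Computable.fst.comp Computable.snd) (Primrec.nat_add.to_comp.comp
    ((computable_tailIndex hm).comp Computable.fst (Computable.fst.comp Computable.snd))
    (Computable.snd.comp Computable.snd))

theorem computable_tailLength {x : ℕ → ℕ → List Bool} {m : ℕ × ℕ → ℕ → ℕ}
    (hx : Computable₂ x) (hm : Computable₂ m) : Computable (tailLength x m) :=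
  Primrec.nat_sub.to_comp.comp
    (Primrec.nat_add.to_comp.comp (Computable.list_length.comp (computable_tailString hx hm))
      (Computable.const 2))
    (Primrec.nat_mul.to_comp.comp (Computable.const 2) Computable.fst)

/-- `m` is a modulus of convergence, uniform in `k`, of the series of the tests `x k`. -/
def IsTestModulus (x : ℕ → ℕ → List Bool) (m : ℕ × ℕ → ℕ → ℕ) : Prop :=
  ∀ k a b : ℕ, 0 < a → 0 < b →
    ∑' i : ℕ, ((2 : ENNReal) ^ (x k (m (a, b) k + i)).length)⁻¹ ≤ (a : ENNReal) / (b : ENNReal)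

section Modulus

variable {x : ℕ → ℕ → List Bool} {m : ℕ × ℕ → ℕ → ℕ}

theorem IsTestModulus.tsum_tailString_le (hm : IsTestModulus x m) (r k : ℕ) :
    ∑' i : ℕ, ((2 : ENNReal) ^ (tailString x m (r, k, i)).length)⁻¹ ≤
      ((2 : ENNReal) ^ (3 * (r + k)))⁻¹ := by
  refine (hm k 1 (8 ^ (r + k)) one_pos (by positivity)).trans (le_of_eq ?_)
  rw [Nat.cast_one, one_div, pow_mul]
  norm_num

/-- A single term is at most the whole tail. This also keeps the subtraction in `tailLength` from
truncating. -/
theorem IsTestModulus.le_length (hm : IsTestModulus x m) {r k n : ℕ}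
    (hn : tailIndex m r k ≤ n) : 3 * (r + k) ≤ (x k n).length := by
  obtain ⟨i, rfl⟩ := Nat.exists_eq_add_of_le hn
  have h := (ENNReal.le_tsum i).trans (hm.tsum_tailString_le r k)
  rw [ENNReal.inv_le_inv] at h
  have h' : 2 ^ (3 * (r + k)) ≤ 2 ^ (x k (tailIndex m r k + i)).length := by exact_mod_cast h
  exact (Nat.pow_le_pow_iff_right one_lt_two).1 h'

theorem IsTestModulus.tendsto_length (hm : IsTestModulus x m) (k : ℕ) :
    Tendsto (fun n => (x k n).length) atTop atTop := by
  refine tendsto_atTop.2 fun r => ?_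
  filter_upwards [eventually_ge_atTop (tailIndex m r k)] with n hn
  have := hm.le_length hn
  omega

theorem IsTestModulus.tailLength_add (hm : IsTestModulus x m) (a : ℕ × ℕ × ℕ) :
    tailLength x m a + 2 * a.1 = (tailString x m a).length + 2 := by
  have : 3 * (a.1 + a.2.1) ≤ (tailString x m a).length := hm.le_length (Nat.le_add_right _ _)
  unfold tailLength
  omega

theorem IsTestModulus.tsum_tailLength_le_one (hm : IsTestModulus x m) :
    ∑' a : ℕ × ℕ × ℕ, ((2 : ENNReal) ^ tailLength x m a)⁻¹ ≤ 1 := by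
  have term : ∀ a : ℕ × ℕ × ℕ, ((2 : ENNReal) ^ tailLength x m a)⁻¹ =
      2 ^ (2 * a.1) * 2⁻¹ ^ 2 * ((2 : ENNReal) ^ (tailString x m a).length)⁻¹ := by
    intro a
    have h := congrArg (fun n : ℕ => (2⁻¹ : ENNReal) ^ n) (hm.tailLength_add a)
    simp only [pow_add] at h
    have hc : (2 : ENNReal) ^ (2 * a.1) * 2⁻¹ ^ (2 * a.1) = 1 := by
      rw [← mul_pow, ENNReal.mul_inv_cancel two_ne_zero ENNReal.ofNat_ne_top, one_pow]
    rw [ENNReal.inv_pow (n := tailLength x m a),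
      ENNReal.inv_pow (n := (tailString x m a).length)]
    calc (2⁻¹ : ENNReal) ^ tailLength x m a
        = 2 ^ (2 * a.1) * (2⁻¹ ^ tailLength x m a * 2⁻¹ ^ (2 * a.1)) := by
          rw [mul_left_comm, hc, mul_one]
      _ = _ := by rw [h]; ring
  have inner : ∀ r k : ℕ, ∑' i : ℕ, ((2 : ENNReal) ^ tailLength x m (r, k, i))⁻¹ ≤
      2⁻¹ ^ (r + 1) * 2⁻¹ ^ (k + 1) := by
    intro r k
    simp only [term]
    rw [ENNReal.tsum_mul_left]
    have hc : (2 : ENNReal) ^ (2 * r) * 2⁻¹ ^ (2 * r) = 1 := by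
      rw [← mul_pow, ENNReal.mul_inv_cancel two_ne_zero ENNReal.ofNat_ne_top, one_pow]
    calc (2 : ENNReal) ^ (2 * r) * 2⁻¹ ^ 2 *
          ∑' i : ℕ, ((2 : ENNReal) ^ (tailString x m (r, k, i)).length)⁻¹
        ≤ 2 ^ (2 * r) * 2⁻¹ ^ 2 * ((2 : ENNReal) ^ (3 * (r + k)))⁻¹ := by
          gcongr
          exact hm.tsum_tailString_le r k
      -- Exponents: `2r - 2 - 3(r + k) = -(r + 1) - (k + 1) - 2k`; the last factor is then dropped,
      -- leaving a product of two geometric series of sum 1.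
      _ = (2 ^ (2 * r) * 2⁻¹ ^ (2 * r)) * (2⁻¹ ^ (r + 1) * 2⁻¹ ^ (k + 1)) * 2⁻¹ ^ (2 * k) := by
          rw [ENNReal.inv_pow (n := 3 * (r + k))]
          generalize (2⁻¹ : ENNReal) = h
          ring
      _ ≤ 2⁻¹ ^ (r + 1) * 2⁻¹ ^ (k + 1) := by
          rw [hc, one_mul]
          exact mul_le_of_le_one_right' (pow_le_one₀ zero_le (by simp))
  have geometric : ∑' n : ℕ, (2⁻¹ : ENNReal) ^ (n + 1) = 1 := by
    rw [ENNReal.tsum_geometric_add_one, ENNReal.one_sub_inv_two, inv_inv,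
      ENNReal.inv_mul_cancel two_ne_zero ENNReal.ofNat_ne_top]
  calc ∑' a : ℕ × ℕ × ℕ, ((2 : ENNReal) ^ tailLength x m a)⁻¹
      = ∑' r, ∑' k, ∑' i, ((2 : ENNReal) ^ tailLength x m (r, k, i))⁻¹ := by
        rw [ENNReal.tsum_prod']
        exact tsum_congr fun r => ENNReal.tsum_prod'
    _ ≤ ∑' r : ℕ, ∑' k : ℕ, (2⁻¹ : ENNReal) ^ (r + 1) * 2⁻¹ ^ (k + 1) :=
        ENNReal.tsum_le_tsum fun r => ENNReal.tsum_le_tsum fun k => inner r k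
    _ = 1 := by
        simp only [ENNReal.tsum_mul_left, geometric, mul_one]

/-- The 3 consists of the 2 bits that bring the total weight below 1 and the extra bit of the Kraft
code. -/
theorem IsTestModulus.exists_monotone_operation (hm : IsTestModulus x m) (hx : Computable₂ x)
    (hmc : Computable₂ m) : ∃ ψ : Set (List Bool × List Bool), IsMonotoneRepresentation ψ ∧
      ∀ r k n : ℕ, tailIndex m r k ≤ n →
        monotoneComplexity ψ (x k n) + (2 * r : ℕ) ≤ ((x k n).length + 3 : ℕ) := by
  set d : ℕ → ℕ × ℕ × ℕ := Denumerable.ofNat (ℕ × ℕ × ℕ) with hd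
  have hdc : Computable d := (Primrec.ofNat (ℕ × ℕ × ℕ)).to_comp
  set e : ℕ → ℕ := fun s => tailLength x m (d s) with he
  set y : ℕ → List Bool := fun s => tailString x m (d s) with hy
  have hsum : ∑' s, ((2 : ENNReal) ^ e s)⁻¹ ≤ 1 := by
    refine le_trans (le_of_eq ?_) hm.tsum_tailLength_le_one
    exact (Denumerable.eqv (ℕ × ℕ × ℕ)).symm.tsum_eq
      fun a => ((2 : ENNReal) ^ tailLength x m a)⁻¹
  refine ⟨kraftOperation e y, isMonotoneRepresentation_kraftOperation
    ((computable_tailLength hx hmc).comp hdc) ((computable_tailString hx hmc).comp hdc), ?_⟩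
  intro r k n hn
  obtain ⟨i, rfl⟩ := Nat.exists_eq_add_of_le hn
  have hs : d (Encodable.encode (r, k, i)) = (r, k, i) := Denumerable.ofNat_encode _
  have h := monotoneComplexity_kraftOperation_le y hsum (Encodable.encode (r, k, i))
  simp only [hy, he, hs] at h
  have hl := hm.tailLength_add (r, k, i)
  calc _ ≤ ((tailLength x m (r, k, i) + 1 : ℕ) : ℕ∞) + (2 * r : ℕ) := by gcongr; exact h
    _ = _ := by
      rw [← Nat.cast_add]
      congr 1
      change _ = (tailString x m (r, k, i)).length + 3
      simp only at hl
      omega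

end Modulus

/-! ### The rate -/

/-- A bound for the lengths of the strings of the tests `x k`, `k ≤ r`, that precede
`tailIndex m r k`. -/
def headLength (x : ℕ → ℕ → List Bool) (m : ℕ × ℕ → ℕ → ℕ) (r : ℕ) : ℕ :=
  r + ∑ k ∈ Finset.range (r + 1), ∑ n ∈ Finset.range (tailIndex m r k), (x k n).length

theorem computable_headLength {x : ℕ → ℕ → List Bool} {m : ℕ × ℕ → ℕ → ℕ}
    (hx : Computable₂ x) (hm : Computable₂ m) : Computable (headLength x m) := by
  have inner : Computable₂ fun r k : ℕ =>
      ∑ n ∈ Finset.range (tailIndex m r k), (x k n).length :=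
    Computable.sum_range (f := fun (q : ℕ × ℕ) n => (x q.2 n).length)
      (computable_tailIndex hm)
      (Computable.list_length.comp
        (hx.comp (Computable.snd.comp Computable.fst) Computable.snd)).to₂
  exact Primrec.nat_add.to_comp.comp Computable.id (Computable.sum_range Computable.succ inner)

theorem length_le_headLength (x : ℕ → ℕ → List Bool) {m : ℕ × ℕ → ℕ → ℕ} {r k n : ℕ}
    (hk : k ≤ r) (hn : n < tailIndex m r k) : (x k n).length ≤ headLength x m r := by
  refine le_add_left (le_trans ?_ (Finset.single_le_sum
    (f := fun k => ∑ n ∈ Finset.range (tailIndex m r k), (x k n).length)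
    (fun _ _ => Nat.zero_le _) (Finset.mem_range.2 (Nat.lt_succ_of_le hk))))
  exact Finset.single_le_sum (f := fun n => (x k n).length) (fun _ _ => Nat.zero_le _)
    (Finset.mem_range.2 hn)

/-- The summand `r` in `headLength` serves to make it unbounded. -/
theorem exists_le_headLength (x : ℕ → ℕ → List Bool) (m : ℕ × ℕ → ℕ → ℕ) (n : ℕ) :
    ∃ r, n ≤ headLength x m r :=
  ⟨n, Nat.le_add_right _ _⟩

/-- The least `r` such that `n ≤ headLength x m r`. -/
def testRate (x : ℕ → ℕ → List Bool) (m : ℕ × ℕ → ℕ → ℕ) (n : ℕ) : ℕ :=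
  Nat.find (exists_le_headLength x m n)

theorem computable_testRate {x : ℕ → ℕ → List Bool} {m : ℕ × ℕ → ℕ → ℕ}
    (hx : Computable₂ x) (hm : Computable₂ m) : Computable (testRate x m) := by
  refine Computable.find (P := fun n r => n ≤ headLength x m r) ?_ (exists_le_headLength x m)
  exact Computable.computablePred (Primrec.nat_le.decide.to_comp.comp Computable.fst
    ((computable_headLength hx hm).comp Computable.snd))

theorem monotone_testRate (x : ℕ → ℕ → List Bool) (m : ℕ × ℕ → ℕ → ℕ) :
    Monotone (testRate x m) := fun _ b hab =>
  Nat.find_min' _ (hab.trans (Nat.find_spec (exists_le_headLength x m b)))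

theorem exists_le_testRate (x : ℕ → ℕ → List Bool) (m : ℕ × ℕ → ℕ → ℕ) (M : ℕ) :
    ∃ n, M ≤ testRate x m n := by
  -- The witness exceeds every `headLength x m r` with `r < M`.
  refine ⟨∑ r ∈ Finset.range M, headLength x m r + 1, (Nat.le_find_iff _ _).2 fun r hr => ?_⟩
  have := Finset.single_le_sum (f := headLength x m) (fun _ _ => Nat.zero_le _)
    (Finset.mem_range.2 hr)
  omega

/-- A string before the tail would be no longer than `headLength x m r`, against the minimality of
the rate. -/
theorem tailIndex_le_of_lt_testRate {x : ℕ → ℕ → List Bool} {m : ℕ × ℕ → ℕ → ℕ} {r k n : ℕ}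
    (hk : k ≤ r) (hr : r < testRate x m (x k n).length) : tailIndex m r k ≤ n := by
  by_contra! hn
  exact Nat.find_min _ hr (length_le_headLength x hk hn)

theorem length_initial (ω : ℕ → Bool) (n : ℕ) : (initial ω n).length = n := by
  simp [initial]

theorem theorem1 (x : ℕ → ℕ → List Bool) (hx : IsComputableTestSequence x) :
    ∃ ρ : ℕ → ℕ, Computable ρ ∧ Monotone ρ ∧ (∀ M : ℕ, ∃ n : ℕ, M ≤ ρ n) ∧
      ∀ ψ : Set (List Bool × List Bool), IsOptimalMonotone ψ →
        ∀ ω : ℕ → Bool,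
          (∃ c : ℕ, ∀ᶠ n : ℕ in atTop,
            (n : ℕ∞) ≤ monotoneComplexity ψ (initial ω n) + (ρ n : ℕ∞) + (c : ℕ∞)) →
          ∀ k : ℕ, PassesTest ω (x k) := by
  obtain ⟨hxc, m, hmc, hm⟩ := hx
  have hm : IsTestModulus x m := hm
  obtain ⟨ψ', hψ', hsave⟩ := hm.exists_monotone_operation hxc hmc
  refine ⟨testRate x m, computable_testRate hxc hmc, monotone_testRate x m,
    exists_le_testRate x m, ?_⟩
  rintro ψ ⟨-, hopt⟩ ω ⟨c, hc⟩ k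
  obtain ⟨c', hc'⟩ := hopt ψ' hψ'
  have hrate : Tendsto (testRate x m) atTop atTop :=
    tendsto_atTop_atTop_of_monotone (monotone_testRate x m) (exists_le_testRate x m)
  -- As the lengths tend to infinity, statements about almost all lengths pass to almost all indices
  -- of the test. In the threshold, `k` ensures `k ≤ r`, and the rest contradicts `r ≤ c + c' + 4`,
  -- which the two complexity bounds give.
  filter_upwards [(hm.tendsto_length k).eventually hc,
    (hrate.comp (hm.tendsto_length k)).eventually_ge_atTop (k + c + c' + 6)] with n hn hρ
  rintro ⟨l, hl⟩
  have hlen : (x k n).length = l := by rw [hl, length_initial]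
  rw [hlen, ← hl] at hn
  simp only [Function.comp_apply, hlen] at hρ
  obtain ⟨r, hr⟩ : ∃ r, testRate x m l = r + 1 := ⟨testRate x m l - 1, by omega⟩
  have hs := hsave r k n (tailIndex_le_of_lt_testRate (x := x) (by omega) (by rw [hlen]; omega))
  -- Finiteness moves the final comparison from `ℕ∞` to `ℕ`.
  have hfin : monotoneComplexity ψ' (x k n) ≠ ⊤ := by
    intro h
    rw [h, top_add] at hs
    exact absurd hs (by simp)
  obtain ⟨K, hK⟩ := ENat.ne_top_iff_exists.1 hfin
  have hle := hn.trans (add_le_add_left (add_le_add_left (hc' (x k n)) _) _)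
  rw [← hK] at hs hle
  rw [hlen] at hs
  norm_cast at hs hle
  omega
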